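/- **Corollary 3.3.** Let $M$ be a smooth 12-dimensional Riemannian manifold with Levi-Civita connection $\nabla^{TM}$ and curvature $R^{TM}=(\nabla^{TM})^2$, and put $$\widehat{A}(TM,\nabla^{TM})={\det}^{1/2}\left(\frac{\frac{\sqrt{-1}}{4\pi}R^{TM}}{\sinh\left(\frac{\sqrt{-1}}{4\pi}R^{TM}\right)}\right),\qquad \widehat{L}(TM,\nabla^{TM})={\det}^{1/2}\left(\frac{\frac{\sqrt{-1}}{2\pi}R^{TM}}{\tanh\left(\frac{\sqrt{-1}}{4\pi}R^{TM}\right)}\right).$$ Let $\xi$ be a complex line bundle on $M$, that is, a smooth oriented real Euclidean vector bundle of rank two, with a Euclidean (metric-preserving) connection $\nabla^{\xi}$ whose curvature is $R^{\xi}$. Let $c=e(\xi,\nabla^{\xi})$ be its Euler form, i.e. the 2-form $c(X,Y)=\frac{1}{2\pi}\langle e_1,R^{\xi}(X,Y)e_2\rangle$ for any oriented orthonormal basis $(e_1,e_2)$ of a fibre of $\xi$. Functions of curvatures and of forms are defined by their Taylor series at $0$, and $\{\omega\}^{(12)}$ denotes the component of degree 12 of a differential form $\omega$. Then, as differential forms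 on $M$, $$\left\{\widehat{L}(TM,\nabla^{TM})\,\frac{\sinh^4\left(\frac{c}{2}\right)}{\cosh^4\left(\frac{c}{2}\right)}\right\}^{(12)}=-128\left\{\widehat{A}(TM,\nabla^{TM})\,\sinh^4\left(\frac{c}{2}\right)\right\}^{(12)}.$$ -/

import Mathlib

open Bundle
open scoped Manifold ContDiff Topology

noncomputable section

namespace CharForm

/-! ### The algebra of complex-valued exterior forms on a real vector space -/

/-- Complex-valued exterior forms on a real (finite-dimensional) vector space `V`: the complex
exterior algebra on the complex-valued covectors, i.e. `Λ(V*) ⊗ ℂ`. -/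
abbrev Forms (V : Type*) [AddCommGroup V] [Module ℝ V] : Type _ :=
  ExteriorAlgebra ℂ (V →ₗ[ℝ] ℂ)

/-- Forms of even degree (an exterior algebra is the Clifford algebra of the zero form). -/
abbrev EvenForms (V : Type*) [AddCommGroup V] [Module ℝ V] : Type _ :=
  CliffordAlgebra.even (0 : QuadraticForm ℂ (V →ₗ[ℝ] ℂ))

section Algebra

variable {V : Type*} [AddCommGroup V] [Module ℝ V]

theorem pair_mul_vector (a b c : V →ₗ[ℝ] ℂ) :
    (ExteriorAlgebra.ι ℂ a * ExteriorAlgebra.ι ℂ b) * ExteriorAlgebra.ι ℂ c =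
      ExteriorAlgebra.ι ℂ c * (ExteriorAlgebra.ι ℂ a * ExteriorAlgebra.ι ℂ b) := by
  have h1 := eq_neg_of_add_eq_zero_left (ExteriorAlgebra.ι_add_mul_swap (R := ℂ) b c)
  have h2 := eq_neg_of_add_eq_zero_left (ExteriorAlgebra.ι_add_mul_swap (R := ℂ) a c)
  rw [mul_assoc, h1, mul_neg, ← mul_assoc, h2, neg_mul, neg_neg, mul_assoc]

theorem evenForms_mul_comm (x y : EvenForms V) : x * y = y * x := by
  obtain ⟨x, hx⟩ := x
  obtain ⟨y, hy⟩ := y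
  apply Subtype.ext
  change x * y = y * x
  refine CliffordAlgebra.even_induction (motive := fun x _ => x * y = y * x)
    (0 : QuadraticForm ℂ (V →ₗ[ℝ] ℂ)) ?_ ?_ ?_ x hx
  · intro r
    exact Algebra.commutes r y
  · intro a b _ _ ha hb
    rw [add_mul, mul_add, ha, hb]
  · intro m₁ m₂ a _ ha
    have key : ∀ z ∈ CliffordAlgebra.evenOdd (0 : QuadraticForm ℂ (V →ₗ[ℝ] ℂ)) 0,
        CliffordAlgebra.ι (0 : QuadraticForm ℂ (V →ₗ[ℝ] ℂ)) m₁ * CliffordAlgebra.ι _ m₂ * z =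
          z * (CliffordAlgebra.ι (0 : QuadraticForm ℂ (V →ₗ[ℝ] ℂ)) m₁ *
            CliffordAlgebra.ι _ m₂) := by
      intro z hz
      refine CliffordAlgebra.even_induction (motive := fun z _ =>
        CliffordAlgebra.ι (0 : QuadraticForm ℂ (V →ₗ[ℝ] ℂ)) m₁ * CliffordAlgebra.ι _ m₂ * z =
          z * (CliffordAlgebra.ι (0 : QuadraticForm ℂ (V →ₗ[ℝ] ℂ)) m₁ *
            CliffordAlgebra.ι _ m₂)) (0 : QuadraticForm ℂ (V →ₗ[ℝ] ℂ)) ?_ ?_ ?_ z hz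
      · intro r
        exact (Algebra.commutes r _).symm
      · intro a b _ _ ha hb
        rw [add_mul, mul_add, ha, hb]
      · intro n₁ n₂ w _ hw
        have e1 := pair_mul_vector m₁ m₂ n₁
        have e2 := pair_mul_vector m₁ m₂ n₂
        simp only [ExteriorAlgebra.ι] at e1 e2
        rw [← mul_assoc, ← mul_assoc, e1, mul_assoc (CliffordAlgebra.ι _ n₁), e2, ← mul_assoc,
          mul_assoc, hw, ← mul_assoc]
    rw [mul_assoc, ha, ← mul_assoc, key y hy, mul_assoc]

instance instCommRingEvenForms : CommRing (EvenForms V) :=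
  { (inferInstance : Ring (EvenForms V)) with mul_comm := evenForms_mul_comm }

/-- The homogeneous component of degree `k` of an even form. -/
def component (k : ℕ) (a : EvenForms V) : Forms V :=
  GradedAlgebra.proj (fun i : ℕ => ⋀[ℂ]^i (V →ₗ[ℝ] ℂ)) k (a : Forms V)

/-- The degree-zero part of an even form, as a number. -/
def scalarPart (a : EvenForms V) : ℂ :=
  ExteriorAlgebra.algebraMapInv (a : Forms V)

/-- The 2-form with values `φ u v`, i.e. `½ ∑ φ(bᵢ, bⱼ) bⁱ ∧ bʲ` for a basis `b` of `V` with dual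
basis `bⁱ`; for `φ` bilinear and alternating this does not depend on `b`. -/
def twoForm [FiniteDimensional ℝ V] (φ : V → V → ℝ) : EvenForms V :=
  let b := Module.finBasis ℝ V
  ∑ i, ∑ j, (((1 / 2 : ℝ) * φ (b i) (b j) : ℝ) : ℂ) •
    (CliffordAlgebra.even.ι (0 : QuadraticForm ℂ (V →ₗ[ℝ] ℂ))).bilin
      (Complex.ofRealLI.toLinearMap ∘ₗ b.coord i) (Complex.ofRealLI.toLinearMap ∘ₗ b.coord j)

end Algebra

/-! ### Power series evaluated at nilpotent elements -/

/-- `f(a) = ∑ₖ fₖ aᵏ` for a nilpotent `a`, where the sum has finitely many non-zero terms. -/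
def evalSeries {A : Type*} [Ring A] [Algebra ℂ A] (f : PowerSeries ℂ) (a : A) : A :=
  ∑ᶠ k : ℕ, PowerSeries.coeff k f • a ^ k

/-- The Taylor series of `sinh x`. -/
def sinhSeries : PowerSeries ℂ :=
  PowerSeries.mk fun k => if Odd k then ((k.factorial : ℂ))⁻¹ else 0

/-- The Taylor series of `cosh x`. -/
def coshSeries : PowerSeries ℂ :=
  PowerSeries.mk fun k => if Even k then ((k.factorial : ℂ))⁻¹ else 0

/-- The Taylor series of `tanh x = sinh x / cosh x`. -/
def tanhSeries : PowerSeries ℂ := sinhSeries * coshSeries⁻¹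

/-- The Taylor series of `x / sinh x`: the inverse of the series of `sinh x / x`. -/
def xDivSinhSeries : PowerSeries ℂ :=
  (PowerSeries.mk fun k => PowerSeries.coeff (k + 1) sinhSeries)⁻¹

/-- The Taylor series of `x / tanh x = cosh x * (x / sinh x)`. -/
def xDivTanhSeries : PowerSeries ℂ := coshSeries * xDivSinhSeries

section Roots

variable {V : Type*} [AddCommGroup V] [Module ℝ V]

/-- The square root of an even form `a` with non-zero scalar part `a₀`: it is
`√a₀ (1 + y)^{1/2}`, with the principal root of `a₀` and the binomial series in the nilpotent form
`y = a / a₀ - 1`. -/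
def sqrtForm (a : EvenForms V) : EvenForms V :=
  (scalarPart a ^ (1 / 2 : ℂ)) •
    evalSeries (PowerSeries.binomialSeries ℂ (1 / 2 : ℂ)) ((scalarPart a)⁻¹ • a - 1)

/-- `det^{1/2} (A)` for a square matrix of even forms. -/
def sqrtDet {r : ℕ} (A : Matrix (Fin r) (Fin r) (EvenForms V)) : EvenForms V :=
  sqrtForm A.det

/-- `sinh a` for a nilpotent even form. -/
def sinhForm (a : EvenForms V) : EvenForms V := evalSeries sinhSeries a

/-- `tanh a` for a nilpotent even form. -/
def tanhForm (a : EvenForms V) : EvenForms V := evalSeries tanhSeries a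

end Roots

/-! ### Connections and curvature -/

section Geometry

variable {E : Type*} [NormedAddCommGroup E] [NormedSpace ℝ E]
  {H : Type*} [TopologicalSpace H] {I : ModelWithCorners ℝ E H}
  {M : Type*} [TopologicalSpace M] [ChartedSpace H M] [IsManifold I ∞ M]

instance instFiniteDimensionalTangentSpace [FiniteDimensional ℝ E] (x : M) :
    FiniteDimensional ℝ (TangentSpace I x) :=
  inferInstanceAs (FiniteDimensional ℝ E)

section Bundle

variable {F : Type*} [NormedAddCommGroup F] [NormedSpace ℝ F]
  {N : M → Type*} [TopologicalSpace (TotalSpace F N)]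
  [∀ x, AddCommGroup (N x)] [∀ x, Module ℝ (N x)] [∀ x, TopologicalSpace (N x)]
  [∀ x, IsTopologicalAddGroup (N x)] [∀ x, ContinuousSMul ℝ (N x)]
  [FiberBundle F N]

/-- The curvature `R(u, v) w = ∇_u ∇_Y s - ∇_v ∇_X s - ∇_{[X, Y]} s` at `x` of a smooth connection
on a smooth vector bundle, where `X`, `Y` and `s` are sections that extend `u`, `v` and `w` and are
smooth near `x`. (The result does not depend on the extensions; `FiberBundle.extend` is constant in
a local trivialization.) In `∇ s x u`, the section comes first. -/
def curvature (D : CovariantDerivative I F N) (x : M) (u v : TangentSpace I x) (w : N x) : N x :=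
  let X : Π y : M, TangentSpace I y := FiberBundle.extend E u
  let Y : Π y : M, TangentSpace I y := FiberBundle.extend E v
  let s : Π y : M, N y := FiberBundle.extend F w
  D (fun y => D s y (Y y)) x u - D (fun y => D s y (X y)) x v
    - D s x (VectorField.mlieBracket I X Y x)

/-- The curvature at `x` as a matrix of 2-forms, `Ω^a_b (u, v) = e^a (R(u, v) e_b)`, with respect to
a basis `e` of the fibre. -/
def curvatureMatrix [FiniteDimensional ℝ E] {r : ℕ} (D : CovariantDerivative I F N) (x : M)
    (e : Module.Basis (Fin r) ℝ (N x)) :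
    Matrix (Fin r) (Fin r) (EvenForms (TangentSpace I x)) :=
  Matrix.of fun a b => twoForm fun u v => e.coord a (curvature D x u v (e b))

end Bundle

/-! ### The Levi-Civita connection and its characteristic forms -/

/-- `D` is the Levi-Civita connection of the Riemannian metric on `M`: it is torsion-free and
compatible with the metric. -/
def IsLeviCivita [FiniteDimensional ℝ E] [RiemannianBundle (fun x : M => TangentSpace I x)]
    [IsContMDiffRiemannianBundle I ∞ E (fun x : M => TangentSpace I x)]
    (D : CovariantDerivative I E (TangentSpace I : M → Type _)) : Prop :=
  D.torsion = 0 ∧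
    CovariantDerivative.IsMetricCompatible (V := fun x : M => TangentSpace I x) (F := E) D

section Tangent

variable [FiniteDimensional ℝ E]

/-- The curvature `R` at `x` of a connection on `TM` as a matrix of 2-forms, in a basis of `T_x M`.
The characteristic forms below do not depend on the basis. -/
def tangentCurvatureMatrix (D : CovariantDerivative I E (TangentSpace I : M → Type _)) (x : M) :
    Matrix (Fin (Module.finrank ℝ (TangentSpace I x))) (Fin (Module.finrank ℝ (TangentSpace I x)))
      (EvenForms (TangentSpace I x)) :=
  curvatureMatrix D x (Module.finBasis ℝ (TangentSpace I x))

/-- The form `Â(TM, ∇) = det^{1/2} (y / sinh y)` with `y = (√-1 / 4π) R`. -/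
def aHatForm (D : CovariantDerivative I E (TangentSpace I : M → Type _)) (x : M) :
    EvenForms (TangentSpace I x) :=
  sqrtDet (evalSeries xDivSinhSeries
    ((Complex.I / (4 * (Real.pi : ℂ))) • tangentCurvatureMatrix D x))

/-- The form `L̂(TM, ∇) = det^{1/2} ((√-1 / 2π) R / tanh y) = det^{1/2} (2 (y / tanh y))` with
`y = (√-1 / 4π) R`. -/
def lHatForm (D : CovariantDerivative I E (TangentSpace I : M → Type _)) (x : M) :
    EvenForms (TangentSpace I x) :=
  sqrtDet ((2 : ℂ) • evalSeries xDivTanhSeries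
    ((Complex.I / (4 * (Real.pi : ℂ))) • tangentCurvatureMatrix D x))

end Tangent

/-! ### Oriented Euclidean plane bundles and their Euler forms -/

section Euler

variable [FiniteDimensional ℝ E]
  {N : M → Type*} [TopologicalSpace (TotalSpace (EuclideanSpace ℝ (Fin 2)) N)]
  [∀ x, NormedAddCommGroup (N x)] [∀ x, InnerProductSpace ℝ (N x)]
  [FiberBundle (EuclideanSpace ℝ (Fin 2)) N] [VectorBundle ℝ (EuclideanSpace ℝ (Fin 2)) N]

/-- A family of orientations of the fibres of a plane bundle is an orientation of the bundle if it
is locally constant in local trivializations. -/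
def IsBundleOrientation (o : ∀ x, Orientation ℝ (N x) (Fin 2)) : Prop :=
  ∀ x₀ : M, ∃ o₀ : Orientation ℝ (EuclideanSpace ℝ (Fin 2)) (Fin 2), ∀ᶠ x in 𝓝 x₀,
    ∃ hx : x ∈ (trivializationAt (EuclideanSpace ℝ (Fin 2)) N x₀).baseSet,
      Orientation.map (Fin 2)
        ((trivializationAt (EuclideanSpace ℝ (Fin 2)) N x₀).linearEquivAt ℝ x hx) (o x) = o₀

theorem finrank_fibre (x : M) : Module.finrank ℝ (N x) = 2 := by
  rw [((trivializationAt (EuclideanSpace ℝ (Fin 2)) N x).linearEquivAt ℝ x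
    (FiberBundle.mem_baseSet_trivializationAt' x)).finrank_eq]
  simp

/-- The Euler form `e(N, ∇) = Ω₁₂ / 2π` of an oriented Euclidean plane bundle with a Euclidean
connection, where `Ω₁₂(u, v) = ⟨e₁, R(u, v) e₂⟩` for an oriented orthonormal basis `(e₁, e₂)` of the
fibre (on which it does not depend). It is the first Chern form `(√-1 / 2π) R` of the corresponding
Hermitian line bundle. -/
def eulerForm (D : CovariantDerivative I (EuclideanSpace ℝ (Fin 2)) N)
    (o : ∀ x, Orientation ℝ (N x) (Fin 2)) (x : M) : EvenForms (TangentSpace I x) :=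
  let e := (o x).finOrthonormalBasis two_pos (finrank_fibre x)
  ((1 / (2 * Real.pi) : ℝ) : ℂ) • twoForm fun u v => inner ℝ (e 0) (curvature D x u v (e 1))

end Euler

end Geometry

end CharForm

end

/-!
The identity is one of polynomials in two quantities. Let `J` be the ideal of even forms at a point
generated by the products of two covectors; since `dim M = 12`, a product of fourteen covectors
vanishes, so `J⁷ = 0` (`pairIdeal_pow_eq_bot`). The curvature matrix has entries in `J` and the
Euler form lies in `J`. Write `y = (√-1 / 4π) R`, `t = tr y² ∈ J²` and `u = c / 2`.

Both `x / sinh x = 1 - x² / 6 + ⋯` and `x / tanh x = 1 + x² / 3 + ⋯` are even, hence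
modulo `J⁴` the determinant of either series at `y` sees only `t` (`det_evalSeries_sub_mem`), and
taking square roots gives `Â ≡ 1 - t / 12` and `L̂ ≡ 64 (1 + t / 6)`, with `64 = √2¹²`
(`sqrtDet_smul_evalSeries_sub_mem`). The fourth powers of `sinh u` and `tanh u` are multiples of
`u⁴ ∈ J⁴` with `sinh⁴ u = u⁴ + (2 / 3) u⁶` and `tanh⁴ u = u⁴ - (4 / 3) u⁶`, so that
(`mul_evalSeries_pow_four`)

* `L̂ tanh⁴ u = 64 u⁴ + (32 / 3) t u⁴ - (256 / 3) u⁶`,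
* `Â sinh⁴ u = u⁴ - (1 / 12) t u⁴ + (2 / 3) u⁶`.

The first is `-128` times the second plus `192 u⁴`, and `u⁴` is homogeneous of degree eight, so it
has no component of degree twelve.
-/

noncomputable section

namespace CharForm

/-! ### Taylor coefficients of the characteristic series -/

theorem coeff_sinhSeries (k : ℕ) :
    PowerSeries.coeff k sinhSeries = if Odd k then ((k.factorial : ℂ))⁻¹ else 0 :=
  PowerSeries.coeff_mk _ _

theorem coeff_coshSeries (k : ℕ) :
    PowerSeries.coeff k coshSeries = if Even k then ((k.factorial : ℂ))⁻¹ else 0 :=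
  PowerSeries.coeff_mk _ _

theorem tanhSeries_mul_coshSeries : tanhSeries * coshSeries = sinhSeries := by
  rw [tanhSeries, mul_assoc, PowerSeries.inv_mul_cancel, mul_one]
  rw [← PowerSeries.coeff_zero_eq_constantCoeff_apply, coeff_coshSeries]
  simp

theorem xDivSinhSeries_mul :
    xDivSinhSeries * (PowerSeries.mk fun k => PowerSeries.coeff (k + 1) sinhSeries) = 1 := by
  rw [xDivSinhSeries, PowerSeries.inv_mul_cancel]
  rw [← PowerSeries.coeff_zero_eq_constantCoeff_apply, PowerSeries.coeff_mk, coeff_sinhSeries]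
  simp

theorem coeff_tanhSeries :
    PowerSeries.coeff 0 tanhSeries = 0 ∧ PowerSeries.coeff 1 tanhSeries = 1 ∧
      PowerSeries.coeff 2 tanhSeries = 0 ∧ PowerSeries.coeff 3 tanhSeries = -1 / 3 := by
  have h (k : ℕ) := congrArg (PowerSeries.coeff k) tanhSeries_mul_coshSeries
  simp only [PowerSeries.coeff_mul, Finset.Nat.sum_antidiagonal_eq_sum_range_succ_mk,
    coeff_coshSeries, coeff_sinhSeries] at h
  have h0 := h 0
  have h1 := h 1
  have h2 := h 2
  have h3 := h 3
  norm_num [Finset.sum_range_succ, Nat.even_iff, Nat.odd_iff, Nat.factorial] at h0 h1 h2 h3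
  refine ⟨by simpa using h0, h1, ?_, ?_⟩
  · linear_combination h2 - (1 / 2) * h0
  · linear_combination h3 - (1 / 2) * h1

theorem coeff_xDivSinhSeries :
    PowerSeries.coeff 0 xDivSinhSeries = 1 ∧ PowerSeries.coeff 1 xDivSinhSeries = 0 ∧
      PowerSeries.coeff 2 xDivSinhSeries = -1 / 6 ∧ PowerSeries.coeff 3 xDivSinhSeries = 0 := by
  have h (k : ℕ) := congrArg (PowerSeries.coeff k) xDivSinhSeries_mul
  simp only [PowerSeries.coeff_mul, Finset.Nat.sum_antidiagonal_eq_sum_range_succ_mk,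
    PowerSeries.coeff_mk, coeff_sinhSeries, PowerSeries.coeff_one] at h
  have h0 := h 0
  have h1 := h 1
  have h2 := h 2
  have h3 := h 3
  norm_num [Finset.sum_range_succ, Nat.odd_iff, Nat.factorial] at h0 h1 h2 h3
  refine ⟨by simpa using h0, h1, ?_, ?_⟩
  · linear_combination h2 - (1 / 6) * h0
  · linear_combination h3 - (1 / 6) * h1

theorem coeff_xDivTanhSeries :
    PowerSeries.coeff 0 xDivTanhSeries = 1 ∧ PowerSeries.coeff 1 xDivTanhSeries = 0 ∧
      PowerSeries.coeff 2 xDivTanhSeries = 1 / 3 ∧ PowerSeries.coeff 3 xDivTanhSeries = 0 := by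
  obtain ⟨h0, h1, h2, h3⟩ := coeff_xDivSinhSeries
  refine ⟨?_, ?_, ?_, ?_⟩ <;>
  · rw [xDivTanhSeries, PowerSeries.coeff_mul,
      Finset.Nat.sum_antidiagonal_eq_sum_range_succ_mk]
    norm_num [Finset.sum_range_succ, coeff_coshSeries, h0, h1, h2, h3, Nat.even_iff,
      Nat.factorial]

/-! ### Congruences modulo powers of an ideal -/

section Ideal

variable {A : Type*} [CommRing A] {J : Ideal A} {r : ℕ}

theorem matrix_pow_apply_mem {Y : Matrix (Fin r) (Fin r) A} (hY : ∀ i j, Y i j ∈ J) (k : ℕ)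
    (i j : Fin r) : (Y ^ k) i j ∈ J ^ k := by
  induction k generalizing j with
  | zero => simp
  | succ k ih =>
    rw [pow_succ, pow_succ, Matrix.mul_apply]
    exact Submodule.sum_mem _ fun l _ => Ideal.mul_mem_mul (ih l) (hY l j)

/-- The first-order expansion of a finite product at `1`. -/
theorem prod_one_add_sub_mem {ι : Type*} (s : Finset ι) (b : ι → A) (hb : ∀ i, b i ∈ J) :
    ∏ i ∈ s, (1 + b i) - (1 + ∑ i ∈ s, b i) ∈ J ^ 2 := by
  classical
  induction s using Finset.induction_on with
  | empty => simp
  | insert i s hi ih =>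
    rw [Finset.prod_insert hi, Finset.sum_insert hi]
    have h1 : b i * ∑ j ∈ s, b j ∈ J ^ 2 := by
      rw [pow_two]
      exact Ideal.mul_mem_mul (hb i) (Submodule.sum_mem _ fun j _ => hb j)
    have h2 := Ideal.mul_mem_left (J ^ 2) (1 + b i) ih
    convert add_mem h1 h2 using 1
    ring

/-- The first-order expansion of the determinant at the identity matrix: a permutation other than
the identity moves two indices, so its term in the Leibniz formula has two off-diagonal factors. -/
theorem det_one_add_sub_mem {B : Matrix (Fin r) (Fin r) A} (hB : ∀ i j, B i j ∈ J) :
    (1 + B).det - (1 + B.trace) ∈ J ^ 2 := by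
  rw [Matrix.det_apply, ← Finset.add_sum_erase _ _ (Finset.mem_univ (1 : Equiv.Perm (Fin r)))]
  have h1 : ∏ i, (1 + B) i i - (1 + B.trace) ∈ J ^ 2 := by
    simpa [Matrix.trace] using prod_one_add_sub_mem Finset.univ (fun i => B i i) fun i => hB i i
  have h2 : ∑ σ ∈ Finset.univ.erase (1 : Equiv.Perm (Fin r)),
      Equiv.Perm.sign σ • ∏ i, (1 + B) (σ i) i ∈ J ^ 2 := by
    refine Submodule.sum_mem _ fun σ hσ => Submodule.smul_of_tower_mem _ _ ?_
    obtain ⟨i, hi⟩ : ∃ i, σ i ≠ i := by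
      by_contra! h
      exact (Finset.mem_erase.1 hσ).1 (Equiv.ext h)
    have off (j : Fin r) (hj : σ j ≠ j) : (1 + B) (σ j) j ∈ J := by
      simpa [Matrix.add_apply, Matrix.one_apply_ne hj] using hB (σ j) j
    have hi' : σ i ∈ Finset.univ.erase i := Finset.mem_erase.2 ⟨hi, Finset.mem_univ _⟩
    rw [← Finset.mul_prod_erase _ _ (Finset.mem_univ i), ← Finset.mul_prod_erase _ _ hi',
      ← mul_assoc, pow_two]
    exact Ideal.mul_mem_right _ _
      (Ideal.mul_mem_mul (off i hi) (off (σ i) fun h => hi (σ.injective h)))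
  convert add_mem h1 h2 using 1
  simp
  ring

theorem add_pow_four_of_mem (hJ : J ^ 7 = ⊥) {p q : A} (hp : p ∈ J) (hq : q ∈ J ^ 4) :
    (p + q) ^ 4 = p ^ 4 := by
  have h1 : p ^ 3 * q = 0 := by
    have := Ideal.mul_mem_mul (Ideal.pow_mem_pow hp 3) hq
    rwa [← pow_add, hJ, Ideal.mem_bot] at this
  have h2 : q * q = 0 := by
    have := Ideal.pow_le_pow_right (show 7 ≤ 4 + 4 by norm_num)
      (pow_add J 4 4 ▸ Ideal.mul_mem_mul hq hq)
    rwa [hJ, Ideal.mem_bot] at this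
  linear_combination 4 * h1 + (6 * p ^ 2 + 4 * p * q + q ^ 2) * h2

end Ideal

/-! ### Power series at nilpotent elements -/

theorem evalSeries_eq_sum_range {A : Type*} [Ring A] [Algebra ℂ A] (f : PowerSeries ℂ) {a : A}
    {n : ℕ} (ha : a ^ n = 0) :
    evalSeries f a = ∑ k ∈ Finset.range n, PowerSeries.coeff k f • a ^ k := by
  refine finsum_eq_sum_of_support_subset _ fun k hk => ?_
  by_contra hkn
  refine hk ?_
  have : n ≤ k := by simpa using hkn
  simp [pow_eq_zero_of_le this ha]

theorem evalSeries_eq_add {A : Type*} [Ring A] [Algebra ℂ A] (f : PowerSeries ℂ) {a : A}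
    {m n : ℕ} (ha : a ^ (m + n) = 0) :
    evalSeries f a = ∑ k ∈ Finset.range m, PowerSeries.coeff k f • a ^ k +
      ∑ k ∈ Finset.range n, PowerSeries.coeff (m + k) f • a ^ (m + k) := by
  rw [evalSeries_eq_sum_range f ha, Finset.sum_range_add]

section Series

variable {A : Type*} [CommRing A] [Algebra ℂ A] {J : Ideal A} {r : ℕ}

theorem evalSeries_sub_mem {n : ℕ} (hJ : J ^ n = ⊥) (f : PowerSeries ℂ) {a : A} (ha : a ∈ J)
    (m : ℕ) :
    evalSeries f a - ∑ k ∈ Finset.range m, PowerSeries.coeff k f • a ^ k ∈ J ^ m := by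
  have h0 : a ^ (m + n) = 0 := by
    have : a ^ n ∈ J ^ n := Ideal.pow_mem_pow ha n
    rw [hJ, Ideal.mem_bot] at this
    rw [pow_add, this, mul_zero]
  rw [evalSeries_eq_add f h0, add_sub_cancel_left]
  exact Submodule.sum_mem _ fun k _ => Submodule.smul_of_tower_mem _ _
    (Ideal.pow_le_pow_right (Nat.le_add_right m k) (Ideal.pow_mem_pow ha _))

theorem evalSeries_matrix_sub_mem {n : ℕ} (hJ : J ^ n = ⊥) (f : PowerSeries ℂ)
    {Y : Matrix (Fin r) (Fin r) A} (hY : ∀ i j, Y i j ∈ J) (m : ℕ) (i j : Fin r) :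
    evalSeries f Y i j - (∑ k ∈ Finset.range m, PowerSeries.coeff k f • Y ^ k) i j ∈ J ^ m := by
  have h0 : Y ^ (m + n) = 0 := by
    have : Y ^ n = 0 := by
      ext i j
      have := matrix_pow_apply_mem hY n i j
      rwa [hJ, Ideal.mem_bot] at this
    rw [pow_add, this, mul_zero]
  rw [evalSeries_eq_add f h0, Matrix.add_apply, add_sub_cancel_left, Matrix.sum_apply]
  exact Submodule.sum_mem _ fun k _ => Submodule.smul_of_tower_mem _ _
    (Ideal.pow_le_pow_right (Nat.le_add_right m k) (matrix_pow_apply_mem hY _ i j))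

/-- The determinant of a power series `f` without terms of degree one and three, `f(0) = 1`, in a
matrix `Y` of nilpotent elements: only the trace of `Y²` enters below order four. -/
theorem det_evalSeries_sub_mem {n : ℕ} (hJ : J ^ n = ⊥) {f : PowerSeries ℂ} {b : ℂ}
    (hf : PowerSeries.coeff 0 f = 1 ∧ PowerSeries.coeff 1 f = 0 ∧
      PowerSeries.coeff 2 f = b ∧ PowerSeries.coeff 3 f = 0)
    {Y : Matrix (Fin r) (Fin r) A} (hY : ∀ i j, Y i j ∈ J) :
    (evalSeries f Y).det - (1 + b • (Y ^ 2).trace) ∈ J ^ 4 := by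
  obtain ⟨h0, h1, h2, h3⟩ := hf
  set B := evalSeries f Y - 1 with hB
  have hR (i j : Fin r) : B i j - b • (Y ^ 2) i j ∈ J ^ 4 := by
    have := evalSeries_matrix_sub_mem hJ f hY 4 i j
    simpa [Finset.sum_range_succ, h0, h1, h2, h3, hB, sub_sub] using this
  have hBJ (i j : Fin r) : B i j ∈ J ^ 2 := by
    have := add_mem (Ideal.pow_le_pow_right (by norm_num) (hR i j) : _ ∈ J ^ 2)
      (Submodule.smul_of_tower_mem _ b (matrix_pow_apply_mem hY 2 i j))
    simpa using this
  have hdet := det_one_add_sub_mem hBJ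
  rw [← pow_mul, hB, add_sub_cancel, ← hB] at hdet
  have htr : B.trace - b • (Y ^ 2).trace ∈ J ^ 4 := by
    simp only [Matrix.trace, Matrix.diag_apply, Finset.smul_sum, ← Finset.sum_sub_distrib]
    exact Submodule.sum_mem _ fun i _ => hR i i
  convert add_mem hdet htr using 1
  ring

/-- The product of a form `L ≡ l + m t` modulo `J⁴`, `t ∈ J²`, with the fourth power of a
series `g(u) = u + β u³ + O(u⁴)`, when `J⁷ = 0`: in `g(u)⁴` the remainder meets `u³` and
drops out. -/
theorem mul_evalSeries_pow_four (hJ : J ^ 7 = ⊥) {g : PowerSeries ℂ} {β : ℂ}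
    (hg : PowerSeries.coeff 0 g = 0 ∧ PowerSeries.coeff 1 g = 1 ∧
      PowerSeries.coeff 2 g = 0 ∧ PowerSeries.coeff 3 g = β)
    {u : A} (hu : u ∈ J) {L t : A} {l m : ℂ} (ht : t ∈ J ^ 2)
    (hL : L - (l • 1 + m • t) ∈ J ^ 4) :
    L * evalSeries g u ^ 4 = l • u ^ 4 + m • (t * u ^ 4) + (4 * l * β) • u ^ 6 := by
  obtain ⟨h0, h1, h2, h3⟩ := hg
  have vanish {k : ℕ} (hk : 7 ≤ k) {a : A} (ha : a ∈ J ^ k) : a = 0 := by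
    have := Ideal.pow_le_pow_right hk ha
    rwa [hJ, Ideal.mem_bot] at this
  have hq := evalSeries_sub_mem hJ g hu 4
  simp only [Finset.sum_range_succ, Finset.range_zero, Finset.sum_empty, h0, h1, h2, h3, zero_smul,
    one_smul, add_zero, zero_add, pow_one] at hq
  have hp : u + β • u ^ 3 ∈ J := add_mem hu
    (Submodule.smul_of_tower_mem _ _ (Ideal.pow_mem_of_mem _ hu 3 (by norm_num)))
  have hT := add_pow_four_of_mem hJ hp hq
  rw [add_sub_cancel] at hT
  have e8 : u ^ 8 = 0 := vanish (by norm_num) (Ideal.pow_mem_pow hu 8)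
  have et : t * u ^ 6 = 0 :=
    vanish (by norm_num) (pow_add J 2 6 ▸ Ideal.mul_mem_mul ht (Ideal.pow_mem_pow hu 6))
  have eL : (L - (l • 1 + m • t)) * u ^ 4 = 0 :=
    vanish (by norm_num) (pow_add J 4 4 ▸ Ideal.mul_mem_mul hL (Ideal.pow_mem_pow hu 4))
  rw [hT]
  simp only [Algebra.smul_def, map_mul, map_ofNat, mul_one] at eL ⊢
  set β' := algebraMap ℂ A β
  set l' := algebraMap ℂ A l
  set m' := algebraMap ℂ A m
  linear_combination (1 + β' * u ^ 2) ^ 4 * eL +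
    (l' * (6 * β' ^ 2 + 4 * β' ^ 3 * u ^ 2 + β' ^ 4 * u ^ 4)) * e8 +
    m' * (4 * β' + 6 * β' ^ 2 * u ^ 2 + 4 * β' ^ 3 * u ^ 4 + β' ^ 4 * u ^ 6) * et

end Series

/-! ### The ideal of forms without scalar part -/

section Forms

open scoped Pointwise

variable {V : Type*} [AddCommGroup V] [Module ℝ V]

/-- The products `α ∧ β` of two covectors, as even forms. -/
def covectorPairs (V : Type*) [AddCommGroup V] [Module ℝ V] : Set (EvenForms V) :=
  {x | ∃ α β, (CliffordAlgebra.even.ι (0 : QuadraticForm ℂ (V →ₗ[ℝ] ℂ))).bilin α β = x}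

/-- The ideal of even forms generated by the products `α ∧ β` of two covectors. It consists of the
even forms of positive degree. -/
def pairIdeal (V : Type*) [AddCommGroup V] [Module ℝ V] : Ideal (EvenForms V) :=
  Ideal.span (covectorPairs V)

theorem coe_mem_exteriorPower_of_mem_covectorPairs {x : EvenForms V} (hx : x ∈ covectorPairs V) :
    (x : Forms V) ∈ ⋀[ℂ]^2 (V →ₗ[ℝ] ℂ) := by
  obtain ⟨α, β, rfl⟩ := hx
  change _ ∈ LinearMap.range (ExteriorAlgebra.ι ℂ) ^ 2
  rw [pow_two]
  exact Submodule.mul_mem_mul ⟨α, rfl⟩ ⟨β, rfl⟩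

theorem exteriorPower_eq_bot [FiniteDimensional ℝ V] {n : ℕ} (hn : Module.finrank ℝ V < n) :
    ⋀[ℂ]^n (V →ₗ[ℝ] ℂ) = ⊥ := by
  rw [← Submodule.finrank_eq_zero (R := ℂ), exteriorPower.finrank_eq, Module.finrank_linearMap,
    Module.finrank_self, mul_one, Nat.choose_eq_zero_of_lt hn]

theorem coe_mem_exteriorPower_of_mem_pow {k : ℕ} {x : EvenForms V}
    (hx : x ∈ covectorPairs V ^ k) : (x : Forms V) ∈ ⋀[ℂ]^(2 * k) (V →ₗ[ℝ] ℂ) := by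
  induction k generalizing x with
  | zero =>
    obtain rfl : x = 1 := by simpa using hx
    exact SetLike.GradedOne.one_mem (A := fun i : ℕ => ⋀[ℂ]^i (V →ₗ[ℝ] ℂ))
  | succ k ih =>
    rw [pow_succ] at hx
    obtain ⟨y, hy, z, hz, rfl⟩ := Set.mem_mul.1 hx
    exact SetLike.GradedMul.mul_mem (A := fun i : ℕ => ⋀[ℂ]^i (V →ₗ[ℝ] ℂ)) (ih hy)
      (coe_mem_exteriorPower_of_mem_covectorPairs hz)

/-- Forms of degree above the dimension vanish. -/
theorem pairIdeal_pow_eq_bot [FiniteDimensional ℝ V] {k : ℕ}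
    (hk : Module.finrank ℝ V < 2 * k) : pairIdeal V ^ k = ⊥ := by
  have : pairIdeal V ^ k = Ideal.span (covectorPairs V ^ k) := Submodule.span_pow _ k
  rw [this, Ideal.span_eq_bot]
  intro x hx
  have := coe_mem_exteriorPower_of_mem_pow hx
  rw [exteriorPower_eq_bot hk, Submodule.mem_bot] at this
  exact Subtype.ext this

theorem twoForm_mem_pairIdeal [FiniteDimensional ℝ V] (φ : V → V → ℝ) :
    twoForm φ ∈ pairIdeal V :=
  Submodule.sum_mem _ fun _ _ => Submodule.sum_mem _ fun _ _ =>
    Submodule.smul_of_tower_mem _ _ (Ideal.subset_span ⟨_, _, rfl⟩)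

theorem coe_twoForm_mem [FiniteDimensional ℝ V] (φ : V → V → ℝ) :
    (twoForm φ : Forms V) ∈ ⋀[ℂ]^2 (V →ₗ[ℝ] ℂ) := by
  have : twoForm φ ∈ (⋀[ℂ]^2 (V →ₗ[ℝ] ℂ)).comap
      (CliffordAlgebra.even (0 : QuadraticForm ℂ (V →ₗ[ℝ] ℂ))).val.toLinearMap :=
    Submodule.sum_mem _ fun _ _ => Submodule.sum_mem _ fun _ _ =>
      Submodule.smul_mem _ _ (coe_mem_exteriorPower_of_mem_covectorPairs ⟨_, _, rfl⟩)
  exact this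

/-- The scalar part as an algebra homomorphism. -/
def scalarPartHom (V : Type*) [AddCommGroup V] [Module ℝ V] : EvenForms V →ₐ[ℂ] ℂ :=
  ExteriorAlgebra.algebraMapInv.comp
    (CliffordAlgebra.even (0 : QuadraticForm ℂ (V →ₗ[ℝ] ℂ))).val

theorem scalarPart_eq_zero {x : EvenForms V} (hx : x ∈ pairIdeal V) : scalarPart x = 0 := by
  have : pairIdeal V ≤ RingHom.ker (scalarPartHom V) := by
    refine Ideal.span_le.2 ?_
    rintro _ ⟨α, β, rfl⟩
    change ExteriorAlgebra.algebraMapInv (ExteriorAlgebra.ι ℂ α * ExteriorAlgebra.ι ℂ β) = 0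
    simp [ExteriorAlgebra.algebraMapInv]
  exact this hx

theorem component_add (k : ℕ) (a b : EvenForms V) :
    component k (a + b) = component k a + component k b :=
  map_add (GradedAlgebra.proj (fun i : ℕ => ⋀[ℂ]^i (V →ₗ[ℝ] ℂ)) k) (a : Forms V) b

theorem component_smul (k : ℕ) (z : ℂ) (a : EvenForms V) :
    component k (z • a) = z • component k a :=
  map_smul (GradedAlgebra.proj (fun i : ℕ => ⋀[ℂ]^i (V →ₗ[ℝ] ℂ)) k) z (a : Forms V)

theorem component_eq_zero {k l : ℕ} (hkl : l ≠ k) {a : EvenForms V}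
    (ha : (a : Forms V) ∈ ⋀[ℂ]^l (V →ₗ[ℝ] ℂ)) : component k a = 0 := by
  rw [component, GradedAlgebra.proj_apply]
  exact DirectSum.decompose_of_mem_ne (fun i : ℕ => ⋀[ℂ]^i (V →ₗ[ℝ] ℂ)) ha hkl

/-- The square root of a form with scalar part `z²`, `Re z > 0`, to first order. -/
theorem sqrtForm_sub_mem {n k : ℕ} (hJ : pairIdeal V ^ n = ⊥) {z : ℂ} (hz : 0 < z.re)
    {a y : EvenForms V} (hk : 0 < k) (hy : y ∈ pairIdeal V ^ k)
    (ha : a - z ^ 2 • (1 + y) ∈ pairIdeal V ^ (k * 2)) :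
    sqrtForm a - z • (1 + (1 / 2 : ℂ) • y) ∈ pairIdeal V ^ (k * 2) := by
  have hz0 : z ≠ 0 := by
    rintro rfl
    simp at hz
  have hs : scalarPart a = z ^ 2 := by
    have h1 : a - z ^ 2 • (1 : EvenForms V) ∈ pairIdeal V := by
      have e : a - z ^ 2 • (1 : EvenForms V) = (a - z ^ 2 • (1 + y)) + z ^ 2 • y := by module
      rw [e]
      exact add_mem (Ideal.pow_le_self (by positivity) ha)
        (Submodule.smul_of_tower_mem _ _ (Ideal.pow_le_self hk.ne' hy))
    have h2 : scalarPartHom V (a - z ^ 2 • (1 : EvenForms V)) = 0 := scalarPart_eq_zero h1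
    rw [map_sub, map_smul, map_one, smul_eq_mul, mul_one, sub_eq_zero] at h2
    exact h2
  -- The principal square root of `z ^ 2` is `z`, as `z` lies in the right half-plane.
  have hr : (z ^ 2 : ℂ) ^ (1 / 2 : ℂ) = z := by
    have h := Complex.abs_arg_lt_pi_div_two_iff.2 (Or.inl hz)
    rw [abs_lt] at h
    rw [one_div]
    exact Complex.pow_cpow_nat_inv (n := 2) two_ne_zero (by push_cast; linarith)
      (by push_cast; linarith)
  set w := (z ^ 2)⁻¹ • a - 1 with hw
  have hwy : w - y ∈ pairIdeal V ^ (k * 2) := by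
    have e : w - y = (z ^ 2)⁻¹ • (a - z ^ 2 • (1 + y)) := by
      rw [hw, smul_sub, inv_smul_smul₀ (pow_ne_zero 2 hz0)]
      abel
    rw [e]
    exact Submodule.smul_of_tower_mem _ _ ha
  have hwk : w ∈ pairIdeal V ^ k := by
    have := add_mem (Ideal.pow_le_pow_right (by omega) hwy : _ ∈ pairIdeal V ^ k) hy
    simpa using this
  have hJk : (pairIdeal V ^ k) ^ n = ⊥ := by
    rw [← pow_mul, mul_comm, pow_mul, hJ, ← Ideal.zero_eq_bot, zero_pow hk.ne']
  have hq := evalSeries_sub_mem hJk (PowerSeries.binomialSeries ℂ (1 / 2 : ℂ)) hwk 2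
  rw [← pow_mul] at hq
  simp only [Finset.sum_range_succ, Finset.range_zero, Finset.sum_empty,
    PowerSeries.binomialSeries_coeff, Ring.choose_zero_right, Ring.choose_one_right, smul_eq_mul,
    mul_one, one_smul, pow_zero, pow_one, zero_add] at hq
  rw [sqrtForm, hs, hr]
  have e : z • evalSeries (PowerSeries.binomialSeries ℂ (1 / 2 : ℂ)) w
        - z • (1 + (1 / 2 : ℂ) • y) =
      z • ((evalSeries (PowerSeries.binomialSeries ℂ (1 / 2 : ℂ)) w - (1 + (1 / 2 : ℂ) • w)) +
        (1 / 2 : ℂ) • (w - y)) := by module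
  rw [e]
  exact Submodule.smul_of_tower_mem _ _
    (add_mem hq (Submodule.smul_of_tower_mem _ _ hwy))

/-- `det^{1/2} (s f(Y))` for a series `f = 1 + b x² + O(x⁴)` and an `r × r` matrix `Y` of forms of
positive degree; `z` is the root of `s^r`. -/
theorem sqrtDet_smul_evalSeries_sub_mem {n r : ℕ} (hJ : pairIdeal V ^ n = ⊥) {s z b : ℂ}
    (hz : 0 < z.re) (hsz : s ^ r = z ^ 2) {f : PowerSeries ℂ}
    (hf : PowerSeries.coeff 0 f = 1 ∧ PowerSeries.coeff 1 f = 0 ∧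
      PowerSeries.coeff 2 f = b ∧ PowerSeries.coeff 3 f = 0)
    {Y : Matrix (Fin r) (Fin r) (EvenForms V)} (hY : ∀ i j, Y i j ∈ pairIdeal V) :
    sqrtDet (s • evalSeries f Y) - (z • 1 + (z * b / 2) • (Y ^ 2).trace) ∈ pairIdeal V ^ 4 := by
  have htr : b • (Y ^ 2).trace ∈ pairIdeal V ^ 2 :=
    Submodule.smul_of_tower_mem _ _
      (Submodule.sum_mem _ fun i _ => matrix_pow_apply_mem hY 2 i i)
  have hdet : (s • evalSeries f Y).det - z ^ 2 • (1 + b • (Y ^ 2).trace) ∈ pairIdeal V ^ 4 := by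
    rw [Matrix.det_smul_of_tower, Fintype.card_fin, hsz, ← smul_sub]
    exact Submodule.smul_of_tower_mem _ _ (det_evalSeries_sub_mem hJ hf hY)
  have e : z • (1 : EvenForms V) + (z * b / 2) • (Y ^ 2).trace =
      z • (1 + (1 / 2 : ℂ) • b • (Y ^ 2).trace) := by module
  rw [e]
  exact sqrtForm_sub_mem (k := 2) hJ hz two_pos htr hdet

/-- Before the components of degree twelve are taken, the two sides of the identity differ by a
multiple of `u⁴`. -/
theorem sqrtDet_mul_tanhForm_pow_four (hJ : pairIdeal V ^ 7 = ⊥) {r : ℕ} (hr : r = 12)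
    {Y : Matrix (Fin r) (Fin r) (EvenForms V)} (hY : ∀ i j, Y i j ∈ pairIdeal V)
    {u : EvenForms V} (hu : u ∈ pairIdeal V) :
    sqrtDet ((2 : ℂ) • evalSeries xDivTanhSeries Y) * tanhForm u ^ 4 =
      (-128 : ℂ) • (sqrtDet (evalSeries xDivSinhSeries Y) * sinhForm u ^ 4) +
        (192 : ℂ) • u ^ 4 := by
  have ht : (Y ^ 2).trace ∈ pairIdeal V ^ 2 :=
    Submodule.sum_mem _ fun i _ => matrix_pow_apply_mem hY 2 i i
  -- `64 ^ 2 = 2 ^ 12`: the factor `2` of `L̂` enters once per row of the matrix.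
  have hL := sqrtDet_smul_evalSeries_sub_mem hJ (s := 2) (z := 64) (by norm_num)
    (by rw [hr]; norm_num) coeff_xDivTanhSeries hY
  have hA := sqrtDet_smul_evalSeries_sub_mem hJ (s := 1) (z := 1) (by norm_num)
    (by rw [one_pow, one_pow]) coeff_xDivSinhSeries hY
  rw [one_smul] at hA
  have hsinh : PowerSeries.coeff 0 sinhSeries = 0 ∧ PowerSeries.coeff 1 sinhSeries = 1 ∧
      PowerSeries.coeff 2 sinhSeries = 0 ∧ PowerSeries.coeff 3 sinhSeries = 1 / 6 := by
    simp only [coeff_sinhSeries]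
    norm_num [Nat.odd_iff, Nat.factorial]
  rw [tanhForm, sinhForm, mul_evalSeries_pow_four hJ coeff_tanhSeries hu ht hL,
    mul_evalSeries_pow_four hJ hsinh hu ht hA]
  module

end Forms

/-! ### The curvature of a connection on the tangent bundle -/

section Curvature

variable {E : Type*} [NormedAddCommGroup E] [NormedSpace ℝ E] [FiniteDimensional ℝ E]
  {H : Type*} [TopologicalSpace H] {I : ModelWithCorners ℝ E H}
  {M : Type*} [TopologicalSpace M] [ChartedSpace H M] [IsManifold I ∞ M]

theorem tangentCurvatureMatrix_apply_mem
    (D : CovariantDerivative I E (TangentSpace I : M → Type _)) (x : M)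
    (i j : Fin (Module.finrank ℝ (TangentSpace I x))) :
    tangentCurvatureMatrix D x i j ∈ pairIdeal (TangentSpace I x) := by
  rw [tangentCurvatureMatrix, curvatureMatrix, Matrix.of_apply]
  exact twoForm_mem_pairIdeal _

end Curvature

end CharForm

end

theorem corollary3p3
    {M : Type*} [TopologicalSpace M] [T2Space M] [SecondCountableTopology M]
    [ChartedSpace (EuclideanSpace ℝ (Fin 12)) M] [IsManifold (𝓡 12) ∞ M]
    [RiemannianBundle (fun x : M => TangentSpace (𝓡 12) x)]
    [IsContMDiffRiemannianBundle (𝓡 12) ∞ (EuclideanSpace ℝ (Fin 12))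
      (fun x : M => TangentSpace (𝓡 12) x)]
    (D : CovariantDerivative (𝓡 12) (EuclideanSpace ℝ (Fin 12))
      (TangentSpace (𝓡 12) : M → Type _))
    (hD : CharForm.IsLeviCivita D)
    {N : M → Type*} [TopologicalSpace (TotalSpace (EuclideanSpace ℝ (Fin 2)) N)]
    [∀ x, NormedAddCommGroup (N x)] [∀ x, InnerProductSpace ℝ (N x)]
    [FiberBundle (EuclideanSpace ℝ (Fin 2)) N] [VectorBundle ℝ (EuclideanSpace ℝ (Fin 2)) N]
    [ContMDiffVectorBundle ∞ (EuclideanSpace ℝ (Fin 2)) N (𝓡 12)]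
    [IsContMDiffRiemannianBundle (𝓡 12) ∞ (EuclideanSpace ℝ (Fin 2)) N]
    (o : ∀ x, Orientation ℝ (N x) (Fin 2)) (ho : CharForm.IsBundleOrientation o)
    (D' : CovariantDerivative (𝓡 12) (EuclideanSpace ℝ (Fin 2)) N)
    [CovariantDerivative.ContMDiffCovariantDerivative D' ∞]
    (hD' : D'.IsMetricCompatible) (x : M) :
    CharForm.component 12 (CharForm.lHatForm D x *
        CharForm.tanhForm ((1 / 2 : ℂ) • CharForm.eulerForm D' o x) ^ 4) =
      (-128 : ℂ) • CharForm.component 12 (CharForm.aHatForm D x *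
        CharForm.sinhForm ((1 / 2 : ℂ) • CharForm.eulerForm D' o x) ^ 4) := by
  have hdim : Module.finrank ℝ (TangentSpace (𝓡 12) x) = 12 :=
    finrank_euclideanSpace_fin (𝕜 := ℝ) (n := 12)
  have hJ : CharForm.pairIdeal (TangentSpace (𝓡 12) x) ^ 7 = ⊥ :=
    CharForm.pairIdeal_pow_eq_bot (by rw [hdim]; norm_num)
  set u := (1 / 2 : ℂ) • CharForm.eulerForm D' o x with hu_def
  have hu : u ∈ CharForm.pairIdeal (TangentSpace (𝓡 12) x) :=
    Submodule.smul_of_tower_mem _ _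
      (Submodule.smul_of_tower_mem _ _ (CharForm.twoForm_mem_pairIdeal _))
  have hu2 : (u : CharForm.Forms (TangentSpace (𝓡 12) x)) ∈
      ⋀[ℂ]^2 (TangentSpace (𝓡 12) x →ₗ[ℝ] ℂ) :=
    Submodule.smul_mem _ _ (Submodule.smul_mem _ _ (CharForm.coe_twoForm_mem _))
  have hu4 : CharForm.component 12 (u ^ 4) = 0 :=
    CharForm.component_eq_zero (l := 4 • 2) (by norm_num)
      (SetLike.pow_mem_graded (A := fun i : ℕ => ⋀[ℂ]^i (TangentSpace (𝓡 12) x →ₗ[ℝ] ℂ)) 4 hu2)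
  set Y := (Complex.I / (4 * (Real.pi : ℂ))) • CharForm.tangentCurvatureMatrix D x with hY_def
  have hY (i j) : Y i j ∈ CharForm.pairIdeal (TangentSpace (𝓡 12) x) := by
    rw [hY_def, Matrix.smul_apply]
    exact Submodule.smul_of_tower_mem _ _ (CharForm.tangentCurvatureMatrix_apply_mem D x i j)
  have key := CharForm.sqrtDet_mul_tanhForm_pow_four hJ hdim (Y := Y) hY hu
  rw [CharForm.lHatForm, CharForm.aHatForm, ← hY_def, key, CharForm.component_add,
    CharForm.component_smul, CharForm.component_smul, hu4, smul_zero, add_zero]
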